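/- **Setting.** Let $(\Omega,\mathcal F,\mathbb P)$ be a probability space and let $U=\bigcup_{\tau\in\mathcal S}\tau\subset\mathbb R^d$ be the union of a set $\mathcal S$ of $N$ simplices of dimension $k$ of a finite simplicial complex of dimension at most $k$; integrals over $U$ are with respect to $k$-dimensional surface measure (Lebesgue measure if $k=d$). Let $\chi^j_\tau=c^j_\tau[0,\dots,0,1_\tau,0,\dots,0]^{\rm T}$ (indicator of $\tau$ in the $j$-th entry), $\tau\in\mathcal S$, $1\le j\le q$, with real coefficients $c^j_\tau$ such that these functions are orthonormal in $L^2(U;\mathbb R^q)$. Let $v\in L^2_{\mathbb P}(\Omega;L^2(U;\mathbb R^q))$ be a random vector field with mean zero, and let $(\lambda_i,\phi_i)_{i\ge1}$ be its Karhunen–Loève eigenpairs: the $\phi_i$ are orthonormal eigenfunctions, with eigenvalues $\lambda_1\ge\lambda_2\ge\dots\ge0$, of the covariance operator $(C_vf)(x)=\int_U{\rm Cov}(v(x),v(y))f(y)\,dy$, and $C_v$ vanishes on the orthogonal complement of all the $\phi_i$. Let $M<N$ and suppose that $\phi_1,\dots,\phi_M$ lie in the span of the $\chi^j_\tau$, and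 that $\sum_{i\ge M+1}\lambda_i>0$. **Multilevel basis.** Build a binary tree of cells by splitting the set of barycenters of the simplices recursively by hyperplanes $\{x\cdot n\le t\}$, $\{x\cdot n>t\}$ chosen by some splitting rule (for example the kd-tree rule: $n$ is a coordinate direction of maximal sample variance and $t$ a median of the projections), until each cell at the ends of the tree contains fewer than $n_0$ barycenters. Going from the leaves to the root, attach to the $k$-th cell $B^l_k$ of level $l$ an orthonormal family $e_1,\dots,e_s$: at a leaf, the functions $\chi^j_\tau$ whose barycenters lie in the cell; at any other cell, the functions handed on by its two children. Take a singular value decomposition $A=PDV^{\rm T}$ of the matrix $A=\big((\phi_i,e_j)\big)_{i\le M,\,j\le s}$, with the singular values in nonincreasing order, let $a$ be the rank of $A$, and put $f_j=\sum_iV_{ij}e_i$. The functions $f_1,\dots,f_a$ are handed on to the parent cell, and $\psi^{l,k}_p:=f_p$, $p=a+1,\dots,s$, are the multilevel basis functions of the cell. **Theorem (Detection: Hypothesis Test).** Let $u$ be an observed random field and let $d^{l,k}_p(\omega)=\int_Uu(x,\omega)^{\rm T}\psi^{l,k}_p(x)\,dx$ be its multilevel projection coefficients. If the null hypothesis $H_0:u=v$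 (almost everywhere on $U\times\Omega$) is true, then for every significance level $0<\alpha\le1$, every level $l$, every cell $B^l_k$ and every index $p$, $$\mathbb P\Big(|d^{l,k}_p|\ \ge\ \alpha^{-1/2}\Big(\sum_{i\ge M+1}\lambda_i\Big)^{1/2}\Big)\le\alpha .$$ No assumption on the distribution of $v$ beyond the above is made. -/

import Mathlib

open MeasureTheory ProbabilityTheory
open scoped BigOperators MeasureTheory ProbabilityTheory

noncomputable section

/-! ### The domain: a union of `k`-simplices of a simplicial complex in `ℝ^d` -/

/-- `𝒮` is a finite set of `k`-simplices of the `k`-dimensional simplicial complex `T`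
(a simplex is given by its finite set of vertices, so a `k`-simplex has `k + 1` of them). -/
structure IsSimplicialMesh {d : ℕ}
    (T : Geometry.SimplicialComplex ℝ (EuclideanSpace ℝ (Fin d))) (k : ℕ)
    (𝒮 : Finset (Finset (EuclideanSpace ℝ (Fin d)))) : Prop where
  finite : T.faces.Finite
  dim_le : ∀ τ ∈ T.faces, τ.card ≤ k + 1
  subset : ∀ τ ∈ 𝒮, τ ∈ T.faces
  dim_eq : ∀ τ ∈ 𝒮, τ.card = k + 1

/-- The domain `U`, the union of the simplices of `𝒮`. -/
def meshDomain {d : ℕ} (𝒮 : Finset (Finset (EuclideanSpace ℝ (Fin d)))) :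
    Set (EuclideanSpace ℝ (Fin d)) :=
  ⋃ τ ∈ 𝒮, convexHull ℝ (τ : Set (EuclideanSpace ℝ (Fin d)))

/-- The measure `dx` on `U`: the `k`-dimensional surface measure, that is the Hausdorff measure
`μHE[k]` (normalized so that it is Lebesgue measure in `ℝ^k`), restricted to `U`. -/
def meshMeasure {d : ℕ} (k : ℕ) (𝒮 : Finset (Finset (EuclideanSpace ℝ (Fin d)))) :
    Measure (EuclideanSpace ℝ (Fin d)) :=
  (μHE[k] : Measure (EuclideanSpace ℝ (Fin d))).restrict (meshDomain 𝒮)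

/-- The barycenter of a simplex. -/
def barycenter {d : ℕ} {𝒮 : Finset (Finset (EuclideanSpace ℝ (Fin d)))} (τ : 𝒮) :
    EuclideanSpace ℝ (Fin d) :=
  τ.1.centroid ℝ id

/-- The space `L²(U; ℝ^q)`, with its usual inner product. -/
abbrev L2Space {X : Type*} [MeasurableSpace X] (μ : Measure X) (q : ℕ) : Type _ :=
  Lp (EuclideanSpace ℝ (Fin q)) 2 μ

/-- The functions `χ τ j = c · [0, …, 0, 1_τ, 0, …, 0]` (indicator of `τ` in the `j`-th entry),
for coefficients `c` (depending on `τ` and `j`) that make the whole family orthonormal. -/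
structure IsIndicatorBasis {d k q : ℕ} (𝒮 : Finset (Finset (EuclideanSpace ℝ (Fin d))))
    (χ : 𝒮 → Fin q → L2Space (meshMeasure k 𝒮) q) : Prop where
  eq_indicator : ∀ (τ : 𝒮) (j : Fin q), ∃ c : ℝ,
    χ τ j =ᵐ[meshMeasure k 𝒮]
      (convexHull ℝ (τ.1 : Set (EuclideanSpace ℝ (Fin d)))).indicator
        (fun _ => EuclideanSpace.single j c)
  orthonormal : Orthonormal ℝ (fun p : 𝒮 × Fin q => χ p.1 p.2)

/-! ### Random vector fields and their Karhunen-Loève eigenpairs -/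

/-- The matrix-valued covariance function
`Cov(v(x), v(y)) = [Cov(v_i(x, ·), v_j(y, ·))]_{i,j}`. -/
def covFn {X Ω : Type*} [MeasurableSpace Ω] (P : Measure Ω) {q : ℕ}
    (v : X → Ω → EuclideanSpace ℝ (Fin q)) (x y : X) : Matrix (Fin q) (Fin q) ℝ :=
  Matrix.of fun i j => cov[fun ω => v x ω i, fun ω => v y ω j; P]

/-- The covariance operator `(C_v u)(x) = ∫_U Cov(v(x), v(y)) u(y) dy`. -/
def covOp {X Ω : Type*} [MeasurableSpace X] [MeasurableSpace Ω] (μ : Measure X) (P : Measure Ω)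
    {q : ℕ} (v : X → Ω → EuclideanSpace ℝ (Fin q)) (u : X → EuclideanSpace ℝ (Fin q)) (x : X) :
    EuclideanSpace ℝ (Fin q) :=
  ∫ y, WithLp.toLp 2 ((covFn P v x y).mulVec (u y)) ∂μ

/-- `v` is a square integrable random vector field, `v ∈ L²_P(Ω; L²(U; ℝ^q))`, given as a function
of `(x, ω)`. -/
def IsL2Field {X Ω : Type*} [MeasurableSpace X] [MeasurableSpace Ω] (μ : Measure X)
    (P : Measure Ω) {q : ℕ} (v : X → Ω → EuclideanSpace ℝ (Fin q)) : Prop :=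
  MemLp (fun z : X × Ω => v z.1 z.2) 2 (μ.prod P)

/-- `(lam i, φ i)`, `i = 0, 1, 2, …`, is the system of Karhunen-Loève eigenpairs of the field `v`:
the `φ i` are orthonormal eigenfunctions of the covariance operator with eigenvalues
`lam 0 ≥ lam 1 ≥ … ≥ 0`, and the operator vanishes on the functions orthogonal to all of them, so
that nonzero eigenvalues are listed completely and with their multiplicities. -/
structure IsKLSystem {X Ω : Type*} [MeasurableSpace X] [MeasurableSpace Ω] (μ : Measure X)
    (P : Measure Ω) {q : ℕ} (v : X → Ω → EuclideanSpace ℝ (Fin q)) (lam : ℕ → ℝ)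
    (φ : ℕ → L2Space μ q) : Prop where
  orthonormal : Orthonormal ℝ φ
  antitone : Antitone lam
  nonneg : ∀ i, 0 ≤ lam i
  eigen : ∀ i, covOp μ P v (φ i) =ᵐ[μ] fun x => lam i • φ i x
  exhaustive : ∀ u : L2Space μ q, (∀ i, inner ℝ (φ i) u = 0) → covOp μ P v u =ᵐ[μ] 0

/-! ### The tree of cells and the multilevel basis -/

/-- `A = P D Vᵀ` is a singular value decomposition: `P`, `V` are orthogonal and `D` is a rectangular
diagonal matrix with nonnegative, nonincreasing diagonal entries. -/
structure IsSVD {m s : ℕ} (A : Matrix (Fin m) (Fin s) ℝ) (P : Matrix (Fin m) (Fin m) ℝ)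
    (D : Matrix (Fin m) (Fin s) ℝ) (V : Matrix (Fin s) (Fin s) ℝ) : Prop where
  left_orthogonal : P ∈ Matrix.orthogonalGroup (Fin m) ℝ
  right_orthogonal : V ∈ Matrix.orthogonalGroup (Fin s) ℝ
  diagonal : ∀ (i : Fin m) (j : Fin s), (i : ℕ) ≠ (j : ℕ) → D i j = 0
  nonneg : ∀ i j, 0 ≤ D i j
  nonincreasing : ∀ (i i' : Fin m) (j j' : Fin s),
    (i : ℕ) = (j : ℕ) → (i' : ℕ) = (j' : ℕ) → i ≤ i' → D i' j' ≤ D i j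
  eq_mul : A = P * D * V.transpose

/-- The matrix of inner products `(φ_i, e_j)`. -/
def innerMatrix {H : Type*} [NormedAddCommGroup H] [InnerProductSpace ℝ H] {m s : ℕ}
    (φ : Fin m → H) (e : Fin s → H) : Matrix (Fin m) (Fin s) ℝ :=
  Matrix.of fun i j => inner ℝ (φ i) (e j)

/-- The orthogonalization step in a cell. From the functions `e_1, …, e_s` one forms
`f_j = ∑_i V_{ij} e_i`, where `V` comes from a singular value decomposition of the matrix of inner
products `(φ_i, e_j)`. With `a` the rank of that matrix, the first `a` of the `f_j` are the functions
`C` handed on to the parent cell, and the others are the basis functions `D` of the cell. -/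
def IsSVDStep {H : Type*} [NormedAddCommGroup H] [InnerProductSpace ℝ H] {m : ℕ}
    (φ : Fin m → H) (e C D : List H) : Prop :=
  ∃ (P : Matrix (Fin m) (Fin m) ℝ) (S : Matrix (Fin m) (Fin e.length) ℝ)
    (V : Matrix (Fin e.length) (Fin e.length) ℝ),
    IsSVD (innerMatrix φ e.get) P S V ∧
    C = (List.ofFn fun j => ∑ i, V i j • e.get i).take (innerMatrix φ e.get).rank ∧
    D = (List.ofFn fun j => ∑ i, V i j • e.get i).drop (innerMatrix φ e.get).rank

/-- What is attached to a cell `B^l_k`: the simplices whose barycenters lie in it, the functions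
`C^l_k` and the multilevel basis functions `D^l_k = {ψ^{l,k}_p}`. -/
structure CellData (ι H : Type*) where
  members : Finset ι
  C : List H
  D : List H

/-- Binary trees of cells. -/
inductive CellTree (ι H : Type*) where
  | leaf (B : CellData ι H) : CellTree ι H
  | node (B : CellData ι H) (left right : CellTree ι H) : CellTree ι H

/-- The root cell of a tree. -/
def CellTree.root {ι H : Type*} : CellTree ι H → CellData ι H
  | .leaf B => B
  | .node B _ _ => B

/-- The cells at level `l` (the root is at level `0`). -/
def CellTree.level {ι H : Type*} : CellTree ι H → ℕ → List (CellData ι H)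
  | t, 0 => [t.root]
  | .leaf _, _ + 1 => []
  | .node _ L R, l + 1 => L.level l ++ R.level l

/-- A splitting rule: it tells by which directions `n` and thresholds `t` a cell containing the
points `x i`, `i ∈ S`, may be split into `{x · n ≤ t}` and `{x · n > t}`. -/
abbrev SplitRule (ι : Type*) (d : ℕ) : Type _ :=
  Finset ι → EuclideanSpace ℝ (Fin d) → ℝ → Prop

open scoped Classical in
/-- The kd-tree rule: the direction is a coordinate direction along which the sample variance of the
projected points is maximal, and the threshold is a median of the projections. -/
def kdRule {ι : Type*} {d : ℕ} (x : ι → EuclideanSpace ℝ (Fin d)) : SplitRule ι d :=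
  fun S n t =>
    let variance : Fin d → ℝ := fun j =>
      (∑ i ∈ S, (x i j - (∑ i' ∈ S, x i' j) / S.card) ^ 2) / (S.card - 1 : ℝ)
    ∃ j : Fin d, n = EuclideanSpace.single j 1 ∧ (∀ j', variance j' ≤ variance j) ∧
      S.card ≤ 2 * (S.filter fun i => x i j ≤ t).card ∧
      S.card ≤ 2 * (S.filter fun i => t ≤ x i j).card

open scoped Classical in
/-- `t` is a tree produced from the points `x i`, `i ∈ S`, with the multilevel basis built on it:
* a cell with fewer than `n₀` points is a leaf; there the orthogonalization step is applied to the
  functions `χ i j` (in any order) with `i` in the cell;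
* any other cell is split in two according to the rule, and the orthogonalization step is applied to
  the functions `C` of its two children. -/
def IsMultilevelTree {ι H : Type*} [NormedAddCommGroup H] [InnerProductSpace ℝ H] {d m q : ℕ}
    (x : ι → EuclideanSpace ℝ (Fin d)) (rule : SplitRule ι d) (n₀ : ℕ)
    (φ : Fin m → H) (χ : ι → Fin q → H) : Finset ι → CellTree ι H → Prop
  | S, .leaf B =>
      B.members = S ∧ S.card < n₀ ∧
      ∃ o : List (ι × Fin q), o.Nodup ∧ (∀ p, p ∈ o ↔ p.1 ∈ S) ∧
        IsSVDStep φ (o.map fun p => χ p.1 p.2) B.C B.D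
  | S, .node B L R =>
      B.members = S ∧ n₀ ≤ S.card ∧
      (∃ (n : EuclideanSpace ℝ (Fin d)) (t : ℝ), rule S n t ∧
        IsMultilevelTree x rule n₀ φ χ (S.filter fun i => inner ℝ (x i) n ≤ t) L ∧
        IsMultilevelTree x rule n₀ φ χ (S.filter fun i => ¬ inner ℝ (x i) n ≤ t) R) ∧
      IsSVDStep φ (L.root.C ++ R.root.C) B.C B.D

/-- The projection coefficient `d(ω) = ∫_U u(x, ω)ᵀ ψ(x) dx`. -/
def projCoeff {X Ω : Type*} [MeasurableSpace X] (μ : Measure X) {q : ℕ}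
    (u : X → Ω → EuclideanSpace ℝ (Fin q)) (ψ : L2Space μ q) (ω : Ω) : ℝ :=
  ∫ x, inner ℝ (u x ω) (ψ x) ∂μ

end

/-! ### Singular value decompositions -/

/-! Every multilevel basis function `ψ` is a unit vector orthogonal to the first `M` eigenfunctions:
past the rank, the right singular vectors span the kernel of the matrix of inner products, and
orthonormality survives the passage up the tree because sibling cells involve disjoint sets of
simplices (`IsMultilevelTree.basis_properties`). The map `f ↦ ∫ v(x,·)ᵀ f(x) dx` from L²(U; ℝ^q) to
L²(Ω) has Gram operator `C_v` (`IsL2Field.inner_projOp_eq_integral_covOp`). Hence the second moment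
of the coefficient is `(ψ, C_v ψ)`, which is at most the largest remaining eigenvalue
(`norm_sq_apply_le_of_orthogonal`) and so at most the tail sum. Chebyshev's inequality finishes the
proof. -/

theorem IsSVD.rank_diagonal_le {m s : ℕ} {A : Matrix (Fin m) (Fin s) ℝ}
    {P : Matrix (Fin m) (Fin m) ℝ} {D : Matrix (Fin m) (Fin s) ℝ} {V : Matrix (Fin s) (Fin s) ℝ}
    (h : IsSVD A P D V) : D.rank ≤ A.rank := by
  have hP : P.transpose * P = 1 := (Matrix.mem_orthogonalGroup_iff' _ _).1 h.left_orthogonal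
  have hV : V.transpose * V = 1 := (Matrix.mem_orthogonalGroup_iff' _ _).1 h.right_orthogonal
  have hD : D = P.transpose * A * V := by
    rw [h.eq_mul]
    calc D = (P.transpose * P) * D * (V.transpose * V) := by simp [hP, hV]
      _ = _ := by simp only [Matrix.mul_assoc]
  rw [hD]
  exact (Matrix.rank_mul_le_left _ _).trans (Matrix.rank_mul_le_right _ _)

/-- The columns of the diagonal factor beyond the rank vanish. -/
theorem IsSVD.apply_eq_zero_of_rank_le {m s : ℕ} {A : Matrix (Fin m) (Fin s) ℝ}
    {P : Matrix (Fin m) (Fin m) ℝ} {D : Matrix (Fin m) (Fin s) ℝ} {V : Matrix (Fin s) (Fin s) ℝ}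
    (h : IsSVD A P D V) (i : Fin m) (j : Fin s) (hj : A.rank ≤ j) : D i j = 0 := by
  by_contra hne
  have hij : (i : ℕ) = j := by
    by_contra hij
    exact hne (h.diagonal i j hij)
  have hpos : 0 < D i j := lt_of_le_of_ne (h.nonneg i j) (Ne.symm hne)
  -- The leading block of size `j + 1` is diagonal with entries at least `D i j > 0`, so it is
  -- invertible and the rank exceeds `j`.
  let r : Fin (j + 1) → Fin m := fun a => ⟨a, by omega⟩
  let c : Fin (j + 1) → Fin s := fun a => ⟨a, by omega⟩
  have hdiag : D.submatrix r c = Matrix.diagonal fun a => D (r a) (c a) := by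
    ext a b
    by_cases hab : a = b
    · subst hab; simp
    · rw [Matrix.diagonal_apply_ne _ hab]
      exact h.diagonal _ _ fun hh => hab (Fin.ext hh)
  have hrank : (D.submatrix r c).rank = j + 1 := by
    have hu : IsUnit (D.submatrix r c) := by
      rw [Matrix.isUnit_iff_isUnit_det, hdiag, Matrix.det_diagonal, isUnit_iff_ne_zero]
      refine Finset.prod_ne_zero_iff.2 fun a _ => ne_of_gt (hpos.trans_le ?_)
      refine h.nonincreasing (r a) i (c a) j rfl hij ?_
      rw [Fin.le_def]
      change (a : ℕ) ≤ i
      omega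
    simpa using Matrix.rank_of_isUnit _ hu
  have := (Matrix.rank_submatrix_le D r c).trans h.rank_diagonal_le
  omega

/-! ### Orthonormal lists and the orthogonalization step -/

section InnerProductSpace

variable {H : Type*} [NormedAddCommGroup H] [InnerProductSpace ℝ H]

/-- A list of pairwise orthogonal unit vectors. -/
def IsOrthonormalList (e : List H) : Prop :=
  e.Pairwise (fun x y => inner ℝ x y = 0) ∧ ∀ x ∈ e, ‖x‖ = 1

theorem IsOrthonormalList.orthonormal_get {e : List H} (h : IsOrthonormalList e) :
    Orthonormal ℝ e.get := by
  refine ⟨fun i => h.2 _ (List.get_mem e i), fun i j hij => ?_⟩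
  have hp := List.pairwise_iff_get.1 h.1
  rcases lt_or_gt_of_ne hij with hlt | hlt
  · exact hp i j hlt
  · exact (real_inner_comm _ _).trans (hp j i hlt)

theorem Orthonormal.isOrthonormalList_ofFn {n : ℕ} {f : Fin n → H} (hf : Orthonormal ℝ f) :
    IsOrthonormalList (List.ofFn f) := by
  refine ⟨List.pairwise_ofFn.2 fun i j hij => hf.2 hij.ne, fun x hx => ?_⟩
  obtain ⟨i, rfl⟩ := (List.mem_ofFn' _ _).1 hx
  exact hf.1 i

theorem IsOrthonormalList.sublist {e e' : List H} (h : IsOrthonormalList e)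
    (hs : e'.Sublist e) : IsOrthonormalList e' :=
  ⟨h.1.sublist hs, fun x hx => h.2 x (hs.subset hx)⟩

theorem Orthonormal.sum_smul_of_mem_orthogonalGroup {s : ℕ} {e : Fin s → H}
    (he : Orthonormal ℝ e) {V : Matrix (Fin s) (Fin s) ℝ}
    (hV : V ∈ Matrix.orthogonalGroup (Fin s) ℝ) :
    Orthonormal ℝ fun j => ∑ i, V i j • e i := by
  have hV' : V.transpose * V = 1 := (Matrix.mem_orthogonalGroup_iff' _ _).1 hV
  rw [orthonormal_iff_ite]
  intro j l
  rw [he.inner_sum]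
  have := congrFun (congrFun hV' j) l
  simpa [Matrix.mul_apply, Matrix.one_apply] using this

variable {m : ℕ} {φ : Fin m → H} {e C D : List H}

theorem IsSVDStep.isOrthonormalList (h : IsSVDStep φ e C D) (he : IsOrthonormalList e) :
    IsOrthonormalList C ∧ IsOrthonormalList D := by
  obtain ⟨P, S, V, hS, rfl, rfl⟩ := h
  have := (he.orthonormal_get.sum_smul_of_mem_orthogonalGroup
    hS.right_orthogonal).isOrthonormalList_ofFn
  exact ⟨this.sublist (List.take_sublist _ _), this.sublist (List.drop_sublist _ _)⟩

/-- Keeps the functions handed upwards in the span of the indicators of their own cell, which is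
what makes siblings orthogonal. -/
theorem IsSVDStep.mem_of_forall_mem (h : IsSVDStep φ e C D) {K : Submodule ℝ H}
    (he : ∀ x ∈ e, x ∈ K) : ∀ x ∈ C, x ∈ K := by
  obtain ⟨P, S, V, hS, rfl, rfl⟩ := h
  intro x hx
  obtain ⟨j, rfl⟩ := (List.mem_ofFn' _ _).1 (List.mem_of_mem_take hx)
  exact Submodule.sum_mem _ fun i _ => K.smul_mem _ (he _ (List.get_mem e i))

/-- Since `A V = P S`, the inner products of the `φ i` with the `j`-th new function form the `j`-th
column of `P S`, and columns of `S` past the rank vanish. -/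
theorem IsSVDStep.inner_eq_zero (h : IsSVDStep φ e C D) (i : Fin m) :
    ∀ x ∈ D, inner ℝ (φ i) x = 0 := by
  obtain ⟨P, S, V, hS, rfl, rfl⟩ := h
  intro x hx
  obtain ⟨n, hn, rfl⟩ := List.mem_iff_getElem.1 hx
  rw [List.getElem_drop, List.getElem_ofFn]
  rw [List.length_drop, List.length_ofFn] at hn
  generalize hj : (⟨(innerMatrix φ e.get).rank + n, _⟩ : Fin e.length) = j
  have hle : (innerMatrix φ e.get).rank ≤ j := by rw [← hj]; simp
  have hV : V.transpose * V = 1 := (Matrix.mem_orthogonalGroup_iff' _ _).1 hS.right_orthogonal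
  have hAV : innerMatrix φ e.get * V = P * S := by
    rw [hS.eq_mul, Matrix.mul_assoc, hV, Matrix.mul_one]
  have hcol : (innerMatrix φ e.get * V) i j = 0 := by
    rw [hAV, Matrix.mul_apply]
    exact Finset.sum_eq_zero fun a _ => by rw [hS.apply_eq_zero_of_rank_le a j hle, mul_zero]
  rw [inner_sum, ← hcol, Matrix.mul_apply]
  refine Finset.sum_congr rfl fun a _ => ?_
  rw [inner_smul_right, innerMatrix, Matrix.of_apply, mul_comm]

/-! ### The multilevel basis -/

-- The induction needs the statement about `C` at the root, with its span localized to `S`: the two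
-- halves of a split are disjoint, so the spans of their indicators are orthogonal and the
-- concatenated list is again orthonormal.
open scoped Classical in
theorem IsMultilevelTree.basis_properties {ι : Type*} {d q : ℕ}
    {x : ι → EuclideanSpace ℝ (Fin d)} {rule : SplitRule ι d} {n₀ : ℕ}
    {χ : ι → Fin q → H} (hχ : Orthonormal ℝ fun p : ι × Fin q => χ p.1 p.2)
    (t : CellTree ι H) (S : Finset ι) (ht : IsMultilevelTree x rule n₀ φ χ S t) :
    (IsOrthonormalList t.root.C ∧
      ∀ y ∈ t.root.C, y ∈ Submodule.span ℝ {z | ∃ i ∈ S, ∃ j, χ i j = z}) ∧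
    ∀ l, ∀ B ∈ t.level l, ∀ ψ ∈ B.D, ‖ψ‖ = 1 ∧ ∀ i, inner ℝ (φ i) ψ = 0 := by
  induction t generalizing S with
  | leaf B =>
    obtain ⟨-, -, o, ho, hmem, hstep⟩ := ht
    have he : IsOrthonormalList (o.map fun p => χ p.1 p.2) := by
      refine ⟨List.pairwise_map.2 (ho.imp fun hne => hχ.2 hne), ?_⟩
      intro y hy
      obtain ⟨p, -, rfl⟩ := List.mem_map.1 hy
      exact hχ.1 p
    refine ⟨⟨(hstep.isOrthonormalList he).1, hstep.mem_of_forall_mem ?_⟩, ?_⟩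
    · intro y hy
      obtain ⟨p, hp, rfl⟩ := List.mem_map.1 hy
      exact Submodule.subset_span ⟨p.1, (hmem p).1 hp, p.2, rfl⟩
    · rintro (_ | l) B' hB' ψ hψ
      · obtain rfl : B' = B := by simpa [CellTree.level, CellTree.root] using hB'
        exact ⟨(hstep.isOrthonormalList he).2.2 ψ hψ, fun i => hstep.inner_eq_zero i ψ hψ⟩
      · simp [CellTree.level] at hB'
  | node B L R ihL ihR =>
    obtain ⟨-, -, ⟨n, t, -, hL, hR⟩, hstep⟩ := ht
    obtain ⟨⟨hLo, hLs⟩, hLD⟩ := ihL _ hL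
    obtain ⟨⟨hRo, hRs⟩, hRD⟩ := ihR _ hR
    have he : IsOrthonormalList (L.root.C ++ R.root.C) := by
      refine ⟨List.pairwise_append.2 ⟨hLo.1, hRo.1, fun a ha b hb => ?_⟩, ?_⟩
      · refine Submodule.isOrtho_iff_inner_eq.1 (Submodule.isOrtho_span.2 ?_) a (hLs a ha)
          b (hRs b hb)
        rintro _ ⟨i, hi, j, rfl⟩ _ ⟨i', hi', j', rfl⟩
        refine hχ.2 (i := (i, j)) (j := (i', j')) fun heq => ?_
        obtain rfl : i = i' := (Prod.ext_iff.1 heq).1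
        exact (Finset.mem_filter.1 hi').2 (Finset.mem_filter.1 hi).2
      · intro y hy
        exact (List.mem_append.1 hy).elim (hLo.2 y) (hRo.2 y)
    refine ⟨⟨(hstep.isOrthonormalList he).1, hstep.mem_of_forall_mem ?_⟩, ?_⟩
    · intro y hy
      rcases List.mem_append.1 hy with hy | hy
      · refine Submodule.span_mono ?_ (hLs y hy)
        rintro _ ⟨i, hi, j, rfl⟩
        exact ⟨i, (Finset.mem_filter.1 hi).1, j, rfl⟩
      · refine Submodule.span_mono ?_ (hRs y hy)
        rintro _ ⟨i, hi, j, rfl⟩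
        exact ⟨i, (Finset.mem_filter.1 hi).1, j, rfl⟩
    · rintro (_ | l) B' hB' ψ hψ
      · obtain rfl : B' = B := by simpa [CellTree.level, CellTree.root] using hB'
        exact ⟨(hstep.isOrthonormalList he).2.2 ψ hψ, fun i => hstep.inner_eq_zero i ψ hψ⟩
      · rcases List.mem_append.1 hB' with hB' | hB'
        · exact hLD l B' hB' ψ hψ
        · exact hRD l B' hB' ψ hψ

/-! ### Bounds for an operator diagonalized by an orthonormal family -/

/-- If `T† T` has the orthonormal eigenvectors `φ i`, with nonincreasing eigenvalues `lam i`, and `T`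
vanishes on the vectors orthogonal to all of them, then `‖T ψ‖² ≤ lam M ‖ψ‖²` for every `ψ`
orthogonal to the first `M` of them. -/
theorem norm_sq_apply_le_of_orthogonal [CompleteSpace H] {K : Type*} [NormedAddCommGroup K]
    [InnerProductSpace ℝ K] (T : H →L[ℝ] K) {φ : ℕ → H} (hφ : Orthonormal ℝ φ) {lam : ℕ → ℝ}
    (hlam : Antitone lam) (hlam₀ : ∀ i, 0 ≤ lam i)
    (heig : ∀ i f, inner ℝ (T f) (T (φ i)) = lam i * inner ℝ f (φ i))
    (hzero : ∀ f, (∀ i, inner ℝ (φ i) f = 0) → T f = 0)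
    {M : ℕ} {ψ : H} (hψ : ∀ i < M, inner ℝ (φ i) ψ = 0) :
    ‖T ψ‖ ^ 2 ≤ lam M * ‖ψ‖ ^ 2 := by
  -- The `φ i` need not be complete, so `ψ` is split into a part in the closed span of the remaining
  -- eigenvectors and a part orthogonal to every `φ i`, which `T` kills.
  set W : Submodule ℝ H :=
    (Submodule.span ℝ (Set.range fun i => φ (i + M))).topologicalClosure
  have hφM : Orthonormal ℝ fun i => φ (i + M) := hφ.comp _ (add_left_injective M)
  have : CompleteSpace W := (Submodule.isClosed_topologicalClosure _).completeSpace_coe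
  have hbound : ∀ s ∈ W, ‖T s‖ ^ 2 ≤ lam M * ‖s‖ ^ 2 := by
    have hclosed : IsClosed {s : H | ‖T s‖ ^ 2 ≤ lam M * ‖s‖ ^ 2} :=
      isClosed_le (by fun_prop) (by fun_prop)
    intro s hs
    refine closure_minimal ?_ hclosed hs
    intro s hs
    obtain ⟨c, rfl⟩ := (Finsupp.mem_span_range_iff_exists_finsupp).1 hs
    have h1 : ‖T (c.sum fun i a => a • φ (i + M))‖ ^ 2
        = ∑ i ∈ c.support, lam (i + M) * c i ^ 2 := by
      rw [← real_inner_self_eq_norm_sq]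
      conv_lhs => rw [Finsupp.sum]; arg 3; rw [map_sum]
      rw [inner_sum]
      refine Finset.sum_congr rfl fun i hi => ?_
      rw [map_smul, inner_smul_right, heig, hφM.inner_left_sum (fun j => c j) hi]
      simp only [conj_trivial]
      ring
    have h2 : ‖c.sum fun i a => a • φ (i + M)‖ ^ 2 = ∑ i ∈ c.support, c i ^ 2 := by
      rw [← real_inner_self_eq_norm_sq]
      rw [Finsupp.sum, hφM.inner_sum]
      simp [sq]
    change (_ : ℝ) ≤ _
    rw [h1, h2, Finset.mul_sum]
    exact Finset.sum_le_sum fun i _ =>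
      mul_le_mul_of_nonneg_right (hlam (Nat.le_add_left M i)) (sq_nonneg _)
  obtain ⟨s, hs, r, hr, rfl⟩ := W.exists_add_mem_mem_orthogonal ψ
  have hsφ : ∀ i < M, inner ℝ (φ i) s = 0 := by
    intro i hi
    have hle : W ≤ (Submodule.span ℝ {φ i})ᗮ := by
      refine Submodule.topologicalClosure_minimal _ (Submodule.span_le.2 ?_)
        (Submodule.isClosed_orthogonal _)
      rintro _ ⟨j, rfl⟩
      exact Submodule.mem_orthogonal_singleton_iff_inner_right.2 (hφ.2 (by omega))
    exact Submodule.mem_orthogonal_singleton_iff_inner_right.1 (hle hs)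
  have hTr : T r = 0 := by
    -- For `i < M` both `ψ` and `s` are orthogonal to `φ i`, hence so is `r`; for `i ≥ M`, `φ i`
    -- lies in `W`.
    refine hzero r fun i => ?_
    by_cases hi : i < M
    · have := hψ i hi
      rwa [inner_add_right, hsφ i hi, zero_add] at this
    · refine hr _ (Submodule.le_topologicalClosure _ (Submodule.subset_span ⟨i - M, ?_⟩))
      simp only
      congr 1
      omega
  have hpyth := norm_add_sq_eq_norm_sq_add_norm_sq_real (hr s hs)
  rw [map_add, hTr, add_zero]
  refine (hbound s hs).trans (mul_le_mul_of_nonneg_left ?_ (hlam₀ M))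
  nlinarith [sq_nonneg ‖r‖]

end InnerProductSpace

/-! ### Projection coefficients of a square integrable random field -/

section Field

variable {X Ω : Type*} [MeasurableSpace X] [MeasurableSpace Ω] {μ : Measure X} {P : Measure Ω}
  {q : ℕ} {v : X → Ω → EuclideanSpace ℝ (Fin q)}

/-- The integrability behind both uses of Fubini: the integrand is bounded by `‖v‖ · (‖g‖ ‖h‖)`, a
product of two L² functions on `X × Ω`. The values of `h` may be vectors (`v x` itself) or scalars
(a projection coefficient). -/
theorem IsL2Field.integrable_inner_smul [SFinite μ] [SFinite P] (hv : IsL2Field μ P v)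
    {g : X → EuclideanSpace ℝ (Fin q)} (hg : MemLp g 2 μ)
    {E : Type*} [NormedAddCommGroup E] [NormedSpace ℝ E] {h : Ω → E} (hh : MemLp h 2 P) :
    Integrable (fun z : X × Ω => (inner ℝ (v z.1 z.2) (g z.1) : ℝ) • h z.2) (μ.prod P) := by
  have hv' : MemLp (fun z : X × Ω => v z.1 z.2) 2 (μ.prod P) := hv
  have hgm : AEStronglyMeasurable (fun z : X × Ω => g z.1) (μ.prod P) := hg.1.comp_fst
  have hhm : AEStronglyMeasurable (fun z : X × Ω => h z.2) (μ.prod P) := hh.1.comp_snd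
  have hprod : MemLp (fun z : X × Ω => ‖g z.1‖ * ‖h z.2‖) 2 (μ.prod P) := by
    refine (memLp_two_iff_integrable_sq (hgm.norm.mul hhm.norm)).2 ?_
    simp only [Pi.mul_apply, mul_pow]
    exact Integrable.mul_prod ((memLp_two_iff_integrable_sq_norm hg.1).1 hg)
      ((memLp_two_iff_integrable_sq_norm hh.1).1 hh)
  refine (hv'.norm.integrable_mul hprod).mono ((hv'.1.inner hgm).smul hhm) ?_
  refine Filter.Eventually.of_forall fun z => ?_
  simp only [Pi.mul_apply, norm_smul, norm_mul, norm_norm]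
  rw [← mul_assoc]
  exact mul_le_mul_of_nonneg_right (norm_inner_le_norm _ _) (norm_nonneg _)

theorem IsL2Field.ae_memLp_right [SFinite μ] [SFinite P] (hv : IsL2Field μ P v) :
    ∀ᵐ x ∂μ, MemLp (v x) 2 P := by
  have hv' : MemLp (fun z : X × Ω => v z.1 z.2) 2 (μ.prod P) := hv
  have hsq := ((memLp_two_iff_integrable_sq_norm hv'.1).1 hv').prod_right_ae
  filter_upwards [hv'.1.prodMk_left, hsq] with x hx hx'
  exact (memLp_two_iff_integrable_sq_norm hx).2 hx'

theorem IsL2Field.ae_memLp_left [SFinite μ] [SFinite P] (hv : IsL2Field μ P v) :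
    ∀ᵐ ω ∂P, MemLp (fun x => v x ω) 2 μ := by
  have hv' : MemLp (fun z : X × Ω => v z.1 z.2) 2 (μ.prod P) := hv
  have hsq := ((memLp_two_iff_integrable_sq_norm hv'.1).1 hv').prod_left_ae
  filter_upwards [hv'.1.prod_swap.prodMk_left, hsq] with ω hω hω'
  exact (memLp_two_iff_integrable_sq_norm hω).2 hω'

/-- The projection coefficients are almost surely inner products with the sample path. -/
theorem IsL2Field.ae_exists_projCoeff_eq [SFinite μ] [SFinite P] (hv : IsL2Field μ P v) :
    ∀ᵐ ω ∂P, ∃ V : L2Space μ q, ‖V‖ ^ 2 = ∫ x, ‖v x ω‖ ^ 2 ∂μ ∧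
      ∀ f : L2Space μ q, projCoeff μ v f ω = inner ℝ V f := by
  filter_upwards [hv.ae_memLp_left] with ω hω
  refine ⟨hω.toLp _, ?_, fun f => ?_⟩
  · rw [← real_inner_self_eq_norm_sq, L2.inner_def]
    refine integral_congr_ae ?_
    filter_upwards [hω.coeFn_toLp] with x hx
    rw [hx, real_inner_self_eq_norm_sq]
  · rw [L2.inner_def, projCoeff]
    refine integral_congr_ae ?_
    filter_upwards [hω.coeFn_toLp] with x hx
    rw [hx]

theorem IsL2Field.integrable_integral_norm_sq [SFinite μ] [SFinite P] (hv : IsL2Field μ P v) :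
    Integrable (fun ω => ∫ x, ‖v x ω‖ ^ 2 ∂μ) P := by
  have hv' : MemLp (fun z : X × Ω => v z.1 z.2) 2 (μ.prod P) := hv
  exact ((memLp_two_iff_integrable_sq_norm hv'.1).1 hv').integral_prod_right

theorem IsL2Field.ae_projCoeff_sq_le [SFinite μ] [SFinite P] (hv : IsL2Field μ P v)
    (f : L2Space μ q) :
    ∀ᵐ ω ∂P, projCoeff μ v f ω ^ 2 ≤ (∫ x, ‖v x ω‖ ^ 2 ∂μ) * ‖f‖ ^ 2 := by
  filter_upwards [hv.ae_exists_projCoeff_eq] with ω ⟨V, hV, hf⟩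
  rw [← hV, hf, ← mul_pow, ← sq_abs]
  exact pow_le_pow_left₀ (abs_nonneg _) (abs_real_inner_le_norm _ _) 2

theorem IsL2Field.memLp_projCoeff [SFinite μ] [SFinite P] (hv : IsL2Field μ P v)
    (f : L2Space μ q) : MemLp (projCoeff μ v f) 2 P := by
  have hv' : MemLp (fun z : X × Ω => v z.1 z.2) 2 (μ.prod P) := hv
  have hinner : AEStronglyMeasurable (fun z : X × Ω => (inner ℝ (v z.1 z.2) (f z.1) : ℝ))
      (μ.prod P) := hv'.1.inner (Lp.aestronglyMeasurable f).comp_fst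
  have hmeas : AEStronglyMeasurable (projCoeff μ v f) P := hinner.prod_swap.integral_prod_right'
  rw [memLp_two_iff_integrable_sq hmeas]
  refine (hv.integrable_integral_norm_sq.mul_const (‖f‖ ^ 2)).mono' (hmeas.pow 2) ?_
  filter_upwards [hv.ae_projCoeff_sq_le f] with ω hω
  rwa [Real.norm_of_nonneg (sq_nonneg _)]

theorem IsL2Field.integral_projCoeff_sq_le [SFinite μ] [SFinite P] (hv : IsL2Field μ P v)
    (f : L2Space μ q) :
    ∫ ω, projCoeff μ v f ω ^ 2 ∂P ≤ (∫ ω, ∫ x, ‖v x ω‖ ^ 2 ∂μ ∂P) * ‖f‖ ^ 2 := by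
  rw [← integral_mul_const]
  exact integral_mono_ae (hv.memLp_projCoeff f).integrable_sq
    (hv.integrable_integral_norm_sq.mul_const _) (hv.ae_projCoeff_sq_le f)

/-- The bounded operator `f ↦ ∫_U v(x, ·)ᵀ f(x) dx` from `L²(U; ℝ^q)` to `L²_P(Ω)`. -/
noncomputable def IsL2Field.projOp [SFinite μ] [SFinite P] (hv : IsL2Field μ P v) :
    L2Space μ q →L[ℝ] Lp ℝ 2 P :=
  LinearMap.mkContinuous
    { toFun := fun f => (hv.memLp_projCoeff f).toLp _
      map_add' := fun f g => by
        rw [← MemLp.toLp_add, MemLp.toLp_eq_toLp_iff]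
        -- Additivity is only almost sure: it needs the sample path to be in L².
        filter_upwards [hv.ae_exists_projCoeff_eq] with ω ⟨V, _, hV⟩
        simp only [Pi.add_apply, hV, inner_add_right]
      map_smul' := fun c f => by
        rw [RingHom.id_apply, ← MemLp.toLp_const_smul, MemLp.toLp_eq_toLp_iff]
        filter_upwards [hv.ae_exists_projCoeff_eq] with ω ⟨V, _, hV⟩
        simp only [Pi.smul_apply, hV, inner_smul_right, smul_eq_mul] }
    √(∫ ω, ∫ x, ‖v x ω‖ ^ 2 ∂μ ∂P) fun f => by
      have h0 : 0 ≤ ∫ ω, ∫ x, ‖v x ω‖ ^ 2 ∂μ ∂P :=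
        integral_nonneg fun _ => integral_nonneg fun _ => sq_nonneg _
      refine abs_le_of_sq_le_sq' ?_ (by positivity) |>.2
      rw [mul_pow, Real.sq_sqrt h0]
      refine le_trans (le_of_eq ?_) (hv.integral_projCoeff_sq_le f)
      rw [← real_inner_self_eq_norm_sq, L2.inner_def]
      refine integral_congr_ae ?_
      filter_upwards [(hv.memLp_projCoeff f).coeFn_toLp] with ω hω
      change inner ℝ ((hv.memLp_projCoeff f).toLp _ ω) ((hv.memLp_projCoeff f).toLp _ ω) = _
      rw [hω, real_inner_self_eq_norm_sq, Real.norm_eq_abs, sq_abs]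

theorem IsL2Field.inner_projOp [SFinite μ] [SFinite P] (hv : IsL2Field μ P v)
    (f g : L2Space μ q) :
    inner ℝ (hv.projOp f) (hv.projOp g) = ∫ ω, projCoeff μ v f ω * projCoeff μ v g ω ∂P := by
  rw [L2.inner_def]
  refine integral_congr_ae ?_
  filter_upwards [(hv.memLp_projCoeff f).coeFn_toLp, (hv.memLp_projCoeff g).coeFn_toLp]
    with ω hf hg
  change inner ℝ ((hv.memLp_projCoeff f).toLp _ ω) ((hv.memLp_projCoeff g).toLp _ ω) = _
  rw [hf, hg, real_inner_eq_re_inner, RCLike.inner_apply]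
  simp [mul_comm]

/-! ### The covariance operator -/

theorem integral_apply_eq_zero {w : Ω → EuclideanSpace ℝ (Fin q)} (hw : Integrable w P)
    (h0 : ∫ ω, w ω ∂P = 0) (i : Fin q) : ∫ ω, w ω i ∂P = 0 := by
  have := (EuclideanSpace.proj (𝕜 := ℝ) i).integral_comp_comm hw
  rw [h0, map_zero] at this
  exact this

/-- Centering one factor suffices, because the covariance subtracts the product of the two means. -/
theorem covFn_mulVec_eq_integral {X : Type*}
    {v : X → Ω → EuclideanSpace ℝ (Fin q)} [IsProbabilityMeasure P] {x y : X}
    (hx : MemLp (v x) 2 P) (hy : MemLp (v y) 2 P) (hx0 : ∫ ω, v x ω ∂P = 0)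
    (a : EuclideanSpace ℝ (Fin q)) :
    WithLp.toLp 2 ((covFn P v x y).mulVec a) = ∫ ω, (inner ℝ (v y ω) a : ℝ) • v x ω ∂P := by
  have hxi : ∀ i, MemLp (fun ω => v x ω i) 2 P := fun i =>
    (EuclideanSpace.proj (𝕜 := ℝ) i).comp_memLp' hx
  have hyi : ∀ i, MemLp (fun ω => v y ω i) 2 P := fun i =>
    (EuclideanSpace.proj (𝕜 := ℝ) i).comp_memLp' hy
  have hya : MemLp (fun ω => (inner ℝ (v y ω) a : ℝ)) 2 P := hy.inner_const a
  have hint : Integrable (fun ω => (inner ℝ (v y ω) a : ℝ) • v x ω) P :=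
    memLp_one_iff_integrable.1 (hx.smul (p := 2) (q := 2) (r := 1) hya)
  ext i
  have h1 := (EuclideanSpace.proj (𝕜 := ℝ) i).integral_comp_comm hint
  change _ = EuclideanSpace.proj (𝕜 := ℝ) i _
  rw [← h1]
  have h2 : ∀ ω, EuclideanSpace.proj (𝕜 := ℝ) i ((inner ℝ (v y ω) a : ℝ) • v x ω)
      = ∑ j, v x ω i * v y ω j * a j := by
    intro ω
    change (inner ℝ (v y ω) a : ℝ) * v x ω i = _
    rw [PiLp.inner_apply, Finset.sum_mul]
    refine Finset.sum_congr rfl fun j _ => ?_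
    simp
    ring
  simp_rw [h2]
  have h3 : ∀ j, Integrable (fun ω => v x ω i * v y ω j * a j) P := fun j =>
    ((hxi i).integrable_mul (hyi j)).mul_const _
  rw [integral_finsetSum _ fun j _ => h3 j]
  simp only [Matrix.mulVec, dotProduct]
  refine Finset.sum_congr rfl fun j _ => ?_
  rw [integral_mul_const, covFn, Matrix.of_apply, covariance_eq_sub (hxi i) (hyi j),
    integral_apply_eq_zero (hx.integrable one_le_two) hx0 i, zero_mul, sub_zero]
  rfl

/-- Fubini turns the integral over `y` of the covariance kernel into an expectation of the
projection coefficient times the field. -/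
theorem IsL2Field.ae_covOp_eq [SFinite μ] [IsProbabilityMeasure P] (hv : IsL2Field μ P v)
    (hmean : ∀ᵐ x ∂μ, ∫ ω, v x ω ∂P = 0) (g : L2Space μ q) :
    ∀ᵐ x ∂μ, covOp μ P v g x = ∫ ω, projCoeff μ v g ω • v x ω ∂P := by
  filter_upwards [hv.ae_memLp_right, hmean] with x hx hx0
  have hI := hv.integrable_inner_smul (Lp.memLp g) hx
  calc covOp μ P v g x
      = ∫ y, ∫ ω, (inner ℝ (v y ω) (g y) : ℝ) • v x ω ∂P ∂μ := by
        refine integral_congr_ae ?_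
        filter_upwards [hv.ae_memLp_right] with y hy
        exact covFn_mulVec_eq_integral hx hy hx0 (g y)
    _ = ∫ ω, ∫ y, (inner ℝ (v y ω) (g y) : ℝ) • v x ω ∂μ ∂P := integral_integral_swap hI
    _ = _ := by
        simp_rw [integral_smul_const]
        rfl

/-- The Gram form of the projection operator is the quadratic form of the covariance operator. -/
theorem IsL2Field.inner_projOp_eq_integral_covOp [SFinite μ] [IsProbabilityMeasure P]
    (hv : IsL2Field μ P v) (hmean : ∀ᵐ x ∂μ, ∫ ω, v x ω ∂P = 0) (f g : L2Space μ q) :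
    inner ℝ (hv.projOp f) (hv.projOp g) = ∫ x, inner ℝ (f x) (covOp μ P v g x) ∂μ := by
  have hI := hv.integrable_inner_smul (Lp.memLp f) (hv.memLp_projCoeff g)
  calc inner ℝ (hv.projOp f) (hv.projOp g)
      = ∫ ω, ∫ x, (inner ℝ (v x ω) (f x) : ℝ) • projCoeff μ v g ω ∂μ ∂P := by
        rw [hv.inner_projOp]
        simp_rw [integral_smul_const]
        rfl
    _ = ∫ x, ∫ ω, (inner ℝ (v x ω) (f x) : ℝ) • projCoeff μ v g ω ∂P ∂μ :=
        (integral_integral_swap hI).symm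
    _ = _ := by
        refine integral_congr_ae ?_
        filter_upwards [hv.ae_covOp_eq hmean g, hv.ae_memLp_right] with x hx hx2
        rw [hx, ← integral_inner]
        · refine integral_congr_ae (Filter.Eventually.of_forall fun ω => ?_)
          simp only [inner_smul_right, smul_eq_mul]
          rw [real_inner_comm, mul_comm]
        · exact memLp_one_iff_integrable.1
            (hx2.smul (p := 2) (q := 2) (r := 1) (hv.memLp_projCoeff g))

/-- The variance of a projection coefficient onto a function orthogonal to the first `M`
Karhunen-Loève eigenfunctions. -/
theorem IsKLSystem.integral_projCoeff_sq_le [SFinite μ] [IsProbabilityMeasure P]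
    {lam : ℕ → ℝ} {φ : ℕ → L2Space μ q} (hKL : IsKLSystem μ P v lam φ) (hv : IsL2Field μ P v)
    (hmean : ∀ᵐ x ∂μ, ∫ ω, v x ω ∂P = 0) {M : ℕ} {ψ : L2Space μ q}
    (hψ : ∀ i < M, inner ℝ (φ i) ψ = 0) :
    ∫ ω, projCoeff μ v ψ ω ^ 2 ∂P ≤ lam M * ‖ψ‖ ^ 2 := by
  have key := norm_sq_apply_le_of_orthogonal hv.projOp hKL.orthonormal hKL.antitone hKL.nonneg
    (fun i f => ?_) (fun f hf => ?_) hψ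
  · rw [← real_inner_self_eq_norm_sq, hv.inner_projOp] at key
    simpa only [sq] using key
  · rw [hv.inner_projOp_eq_integral_covOp hmean, L2.inner_def, ← integral_const_mul]
    refine integral_congr_ae ?_
    filter_upwards [hKL.eigen i] with x hx
    rw [hx, inner_smul_right]
  -- The squared norm of the image of `f` is `(f, C_v f)`, which vanishes by exhaustiveness of the
  -- eigensystem.
  · rw [← inner_self_eq_zero (𝕜 := ℝ), hv.inner_projOp_eq_integral_covOp hmean]
    refine integral_eq_zero_of_ae ?_
    filter_upwards [hKL.exhaustive f hf] with x hx
    rw [hx]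
    simp

theorem projCoeff_ae_congr [SFinite μ] [SFinite P] {u : X → Ω → EuclideanSpace ℝ (Fin q)}
    (h : ∀ᵐ z ∂(μ.prod P), u z.1 z.2 = v z.1 z.2) (ψ : L2Space μ q) :
    projCoeff μ u ψ =ᵐ[P] projCoeff μ v ψ := by
  -- The factors are swapped so that the outer quantifier runs over `ω`.
  have h' := Measure.ae_ae_of_ae_prod
    ((Measure.measurePreserving_swap (μ := P) (ν := μ)).quasiMeasurePreserving.ae h)
  filter_upwards [h'] with ω hω
  refine integral_congr_ae ?_
  filter_upwards [hω] with x hx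
  change u x ω = v x ω at hx
  rw [hx]

end Field

/-! ### Finiteness of the surface measure -/

/-- Each `χ τ j` has norm one, so its coefficient is nonzero; a nonzero constant on `τ` is square
integrable only if `τ` has finite measure. Finiteness supplies the s-finiteness required by Fubini.
-/
theorem IsIndicatorBasis.isFiniteMeasure {d k q : ℕ}
    {𝒮 : Finset (Finset (EuclideanSpace ℝ (Fin d)))}
    {χ : 𝒮 → Fin q → L2Space (meshMeasure k 𝒮) q} (hχ : IsIndicatorBasis 𝒮 χ) (hq : 0 < q) :
    IsFiniteMeasure (meshMeasure k 𝒮) := by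
  have hmeas : ∀ τ : Finset (EuclideanSpace ℝ (Fin d)),
      MeasurableSet (convexHull ℝ (τ : Set (EuclideanSpace ℝ (Fin d)))) := fun τ =>
    (τ.finite_toSet.isCompact_convexHull ℝ).measurableSet
  have hsub : ∀ τ ∈ 𝒮, convexHull ℝ (τ : Set (EuclideanSpace ℝ (Fin d))) ⊆ meshDomain 𝒮 :=
    fun τ hτ => Set.subset_biUnion_of_mem (u := fun τ : Finset (EuclideanSpace ℝ (Fin d)) =>
      convexHull ℝ (τ : Set (EuclideanSpace ℝ (Fin d)))) hτ
  have hfin : ∀ τ ∈ 𝒮, (μHE[k] : Measure (EuclideanSpace ℝ (Fin d)))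
      (convexHull ℝ (τ : Set (EuclideanSpace ℝ (Fin d)))) < ⊤ := by
    intro τ hτ
    obtain ⟨c, hc⟩ := hχ.eq_indicator ⟨τ, hτ⟩ ⟨0, hq⟩
    have hne : c ≠ 0 := by
      rintro rfl
      have hzero : χ ⟨τ, hτ⟩ ⟨0, hq⟩ = 0 := by
        refine (Lp.eq_zero_iff_ae_eq_zero).2 (hc.trans (Filter.Eventually.of_forall fun x => ?_))
        simp
      simpa [hzero] using hχ.orthonormal.1 (⟨τ, hτ⟩, ⟨0, hq⟩)
    have hlt := SimpleFunc.measure_lt_top_of_memLp_indicator (p := 2) (by simp) (by simp)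
      (c := EuclideanSpace.single (⟨0, hq⟩ : Fin q) c) (by simpa using hne) (hmeas τ)
      (μ := meshMeasure k 𝒮) ?_
    · rwa [meshMeasure, Measure.restrict_apply (hmeas τ),
        Set.inter_eq_left.2 (hsub τ hτ)] at hlt
    · refine ((memLp_congr_ae hc).1 (Lp.memLp _)).ae_eq
        (Filter.Eventually.of_forall fun x => ?_)
      by_cases hx : x ∈ convexHull ℝ (τ : Set (EuclideanSpace ℝ (Fin d))) <;> simp [hx]
  refine ⟨?_⟩
  rw [meshMeasure, Measure.restrict_apply_univ]
  exact (measure_biUnion_lt_top 𝒮.finite_toSet hfin)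

/-! ### Chebyshev's inequality and the conclusion -/

/-- Chebyshev's inequality, in the form with a significance level. -/
theorem measureReal_le_of_integral_sq_le {Ω : Type*} [MeasurableSpace Ω] {P : Measure Ω}
    [IsFiniteMeasure P] {f : Ω → ℝ} (hf : MemLp f 2 P) {s α : ℝ} (hs : 0 < s)
    (hfs : ∫ ω, f ω ^ 2 ∂P ≤ s) (hα : 0 < α) :
    P.real {ω | α ^ (-(1 / 2) : ℝ) * √s ≤ |f ω|} ≤ α := by
  have hpow : (α ^ (-(1 / 2) : ℝ)) ^ 2 = α⁻¹ := by
    rw [← Real.rpow_natCast, ← Real.rpow_mul hα.le, ← Real.rpow_neg_one]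
    norm_num
  have hset : {ω | α ^ (-(1 / 2) : ℝ) * √s ≤ |f ω|} = {ω | α⁻¹ * s ≤ f ω ^ 2} := by
    ext ω
    change (_ : ℝ) ≤ _ ↔ (_ : ℝ) ≤ _
    rw [← sq_le_sq₀ (by positivity) (abs_nonneg _), mul_pow, Real.sq_sqrt hs.le, hpow, sq_abs]
  have h := mul_meas_ge_le_integral_of_nonneg (μ := P)
    (Filter.Eventually.of_forall fun ω => sq_nonneg (f ω)) hf.integrable_sq (α⁻¹ * s)
  rw [hset]
  have h2 := h.trans hfs
  rw [mul_assoc, inv_mul_le_iff₀ hα, mul_comm α s] at h2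
  exact le_of_mul_le_mul_left h2 hs

theorem mainTheorem2
    {Ω : Type*} [MeasurableSpace Ω] (P : Measure Ω) [IsProbabilityMeasure P]
    (d k q M n₀ : ℕ)
    (T : Geometry.SimplicialComplex ℝ (EuclideanSpace ℝ (Fin d)))
    (𝒮 : Finset (Finset (EuclideanSpace ℝ (Fin d))))
    (hmesh : IsSimplicialMesh T k 𝒮)
    (χ : 𝒮 → Fin q → L2Space (meshMeasure k 𝒮) q)
    (hχ : IsIndicatorBasis 𝒮 χ)
    (v : EuclideanSpace ℝ (Fin d) → Ω → EuclideanSpace ℝ (Fin q))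
    (hv : IsL2Field (meshMeasure k 𝒮) P v)
    (hmean : ∀ᵐ x ∂(meshMeasure k 𝒮), ∫ ω, v x ω ∂P = 0)
    (lam : ℕ → ℝ) (φ : ℕ → L2Space (meshMeasure k 𝒮) q)
    (hKL : IsKLSystem (meshMeasure k 𝒮) P v lam φ)
    (hM : M < 𝒮.card)
    (hφ : ∀ i < M, φ i ∈ Submodule.span ℝ (Set.range fun p : 𝒮 × Fin q => χ p.1 p.2))
    (htail : 0 < ∑' i, lam (i + M))
    (rule : SplitRule 𝒮 d)
    (t : CellTree 𝒮 (L2Space (meshMeasure k 𝒮) q))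
    (ht : IsMultilevelTree barycenter rule n₀ (fun i : Fin M => φ i) χ Finset.univ t)
    (u : EuclideanSpace ℝ (Fin d) → Ω → EuclideanSpace ℝ (Fin q))
    (H₀ : ∀ᵐ z ∂((meshMeasure k 𝒮).prod P), u z.1 z.2 = v z.1 z.2)
    (α : ℝ) (hα₀ : 0 < α) (hα₁ : α ≤ 1)
    (l : ℕ) (B : CellData 𝒮 (L2Space (meshMeasure k 𝒮) q)) (hB : B ∈ t.level l)
    (ψ : L2Space (meshMeasure k 𝒮) q) (hψ : ψ ∈ B.D) :
    P.real {ω | α ^ (-(1 / 2) : ℝ) * √(∑' i, lam (i + M)) ≤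
      |projCoeff (meshMeasure k 𝒮) u ψ ω|} ≤ α := by

  -- For `q = 0` the L² space is trivial and contains no unit vector `φ 0`.
  have hq : 0 < q := by
    by_contra hq
    obtain rfl : q = 0 := by omega
    have hz : φ 0 = 0 :=
      Lp.eq_zero_iff_ae_eq_zero.2 (Filter.Eventually.of_forall fun x => Subsingleton.elim _ _)
    simpa [hz] using hKL.orthonormal.1 0
  have := hχ.isFiniteMeasure hq
  -- A divergent `tsum` has the default value 0, so positivity of the tail forces summability.
  have hsummable : Summable fun i => lam (i + M) := by
    by_contra hns
    rw [tsum_eq_zero_of_not_summable hns] at htail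
    exact lt_irrefl _ htail
  -- Indices start at 0, so `lam M` is the eigenvalue λ_{M+1}, the first term of the tail.
  have hlam : lam M ≤ ∑' i, lam (i + M) := by
    simpa using hsummable.le_tsum 0 fun i _ => hKL.nonneg (i + M)
  obtain ⟨hnorm, horth⟩ :=
    (IsMultilevelTree.basis_properties hχ.orthonormal t _ ht).2 l B hB ψ hψ
  have hvar := hKL.integral_projCoeff_sq_le hv hmean (fun i hi => horth ⟨i, hi⟩)
  rw [hnorm, one_pow, mul_one] at hvar
  refine le_trans (le_of_eq ?_)
    (measureReal_le_of_integral_sq_le (hv.memLp_projCoeff ψ) htail (hvar.trans hlam) hα₀)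
  refine measureReal_congr ?_
  filter_upwards [projCoeff_ae_congr H₀ ψ] with ω hω
  change (_ ≤ _) = (_ ≤ _)
  rw [hω]
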